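/- Let $p(n)$ denote the number of partitions of the nonnegative integer $n$, and let $E_6 = 1 - 504\sum_{n=1}^{\infty}\sigma_5(n)q^n$, where $\sigma_5(n)=\sum_{d\mid n}d^5$. Define integers $e(n)$ and $f(n)$ ($n \ge 0$) by the identities of formal power series in $q$ $$\sum_{n=0}^{\infty} e(n)q^n = E_6\cdot\prod_{n=1}^{\infty}(1-q^n)^5,\qquad \sum_{n=0}^{\infty} f(n)q^n = E_6\cdot\prod_{n=1}^{\infty}(1-q^n)^{23}.$$ Then for all nonnegative integers $k$ and $n$, the numbers $\frac{19^{2k+1}(24n+5)+1}{24}$ and $\frac{19^{2k+2}(24n+23)+1}{24}$ are integers, and $$p\left(\frac{19^{2k+1}(24n+5)+1}{24}\right)\equiv 5\cdot 10^k\cdot e(n)\pmod{19},$$ $$p\left(\frac{19^{2k+2}(24n+23)+1}{24}\right)\equiv 11\cdot 10^k\cdot f(n)\pmod{19}.$$ -/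

import Mathlib

open scoped PowerSeries.WithPiTopology

/-- The partition function `p(n)`: the number of partitions of `n`. -/
def partitionCount (n : ℕ) : ℕ := Fintype.card (Nat.Partition n)

/-- The `q`-expansion `E₆ = 1 - 504 ∑_{n ≥ 1} σ₅(n) q^n`, as a power series in `q = X`. -/
noncomputable def eisensteinSix : PowerSeries ℤ :=
  PowerSeries.mk fun n => if n = 0 then 1 else -504 * (ArithmeticFunction.sigma 5 n : ℤ)

/-- The infinite product `∏_{n ≥ 1} (1 - q^n)^r` in the ring of formal power series over `ℤ`
with its usual topology of coefficientwise convergence (`ℤ` being discrete). -/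
noncomputable def eulerProductPow (r : ℕ) : PowerSeries ℤ :=
  ∏' n : ℕ, (1 - PowerSeries.X ^ (n + 1)) ^ r

/-- The infinite product `∏_{n ≥ 1} (1 - q^n)^r` converges. -/
theorem hasProd_eulerProductPow (r : ℕ) :
    HasProd (fun n : ℕ => ((1 : PowerSeries ℤ) - PowerSeries.X ^ (n + 1)) ^ r)
      (eulerProductPow r) := by
  have h : Multipliable fun n : ℕ => (1 : PowerSeries ℤ) - PowerSeries.X ^ (n + 1) :=
    PowerSeries.WithPiTopology.multipliable_one_sub_X_pow ℤ
  exact (show Multipliable fun n : ℕ => ((1 : PowerSeries ℤ) - PowerSeries.X ^ (n + 1)) ^ r from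
    ⟨_, h.hasProd.map (powMonoidHom r) (continuous_pow r)⟩).hasProd

/-- `e(n)`, the coefficient of `q^n` in `E₆ · ∏_{n ≥ 1} (1 - q^n)^5`. -/
noncomputable def coeffE (n : ℕ) : ℤ := (eisensteinSix * eulerProductPow 5).coeff n

/-- `f(n)`, the coefficient of `q^n` in `E₆ · ∏_{n ≥ 1} (1 - q^n)^23`. -/
noncomputable def coeffF (n : ℕ) : ℤ := (eisensteinSix * eulerProductPow 23).coeff n

/-! Write P, Q, R for E₂, E₄, E₆ modulo 19, θ = q d/dq and η = ∏(1 - qⁿ), with no factor q^(1/24).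

Since 43867·E₁₈ is constant modulo 19 and M₁₈ is spanned by E₄³E₆ and E₆³, there is a relation A :=
R(8Q³ + 12R²) = 1. Ramanujan's equations for θE₄ and θE₆, applied to θA = 0, then give P as a
polynomial of weight 20 in Q and R. So θ maps isobaric polynomials in Q, R to isobaric polynomials
of weight 20 more. Moreover θη = (P - 1)η/24 and qη²⁴ = R² - Q³.

The coefficients at exponents ≡ s (mod 19) are not seen in the image of θ - s, and q^s g(q¹⁹) = q^s
g¹⁹. Hence f - q^s g¹⁹ = (θ - s)W forces ∑ a(19n+s)qⁿ = g, where f = ∑ a(n)qⁿ. With W = η^r w and w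
isobaric, this becomes an identity between polynomials in Q and R over 𝔽₁₉, the powers of A
equalizing weights. It is checked for three explicit w: `multisection_four_eulerProduct_pow`,
`multisection_eighteen_eisensteinSix_mul`, `multisection_three_eisensteinSix_mul`.

Cancelling η¹⁹ = η(q¹⁹) leaves p(19n+4) ≡ 5e(n), e(19n+18) ≡ 6f(n), f(19n+3) ≡ 8e(n). Iterating them
gives the theorem, with 6·8 ≡ 10 and 5·6 ≡ 11. -/

section LevelOneForms

open UpperHalfPlane ModularForm EisensteinSeries Derivative
open scoped Manifold MatrixGroups Topology

/-! ### Expansions in q of the normalized derivative and of E₂ -/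

/-- With F = g ∘ q for the cusp function g, the chain rule gives DF = q·g′(q), and g′ is the sum of
its Taylor series on the unit disc. -/
theorem hasSum_normalizedDerivOfComplex {F : ℍ → ℂ}
    (hper : Function.Periodic (F ∘ ofComplex) (1 : ℝ)) (hhol : MDiff F)
    (hbdd : IsBoundedAtImInfty F) (τ : ℍ) :
    HasSum (fun m : ℕ => ((m : ℂ) * (qExpansion 1 F).coeff m) • Function.Periodic.qParam 1 τ ^ m)
      (normalizedDerivOfComplex F τ) := by
  set g := cuspFunction 1 F with hg
  set q := Function.Periodic.qParam 1 τ with hq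
  have hq1 : ‖q‖ < 1 := Function.Periodic.norm_qParam_lt_one one_pos τ.im_pos
  have hqb : q ∈ Metric.ball (0 : ℂ) 1 := by simpa using hq1
  have hgd : DifferentiableOn ℂ g (Metric.ball 0 1) :=
    differentiableOn_cuspFunction_ball one_pos hper hhol hbdd
  have hsum := Complex.hasSum_taylorSeries_on_ball (hgd.deriv Metric.isOpen_ball) hqb
  have hD : normalizedDerivOfComplex F τ = q * deriv g q := by
    have hev : F ∘ ofComplex =ᶠ[𝓝 (τ : ℂ)] g ∘ Function.Periodic.qParam 1 := by
      filter_upwards [isOpen_upperHalfPlaneSet.mem_nhds τ.im_pos] with w hw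
      have := eq_cuspFunction (h := 1) (f := F) ⟨w, hw⟩ one_ne_zero hper
      simpa [ofComplex_apply_of_im_pos hw] using this.symm
    have hgq : HasDerivAt g (deriv g q) q :=
      ((hgd q hqb).differentiableAt (Metric.isOpen_ball.mem_nhds hqb)).hasDerivAt
    have hqp : HasDerivAt (Function.Periodic.qParam 1) (q * (2 * Real.pi * Complex.I)) (τ : ℂ) := by
      have := ((hasDerivAt_id (τ : ℂ)).const_mul (2 * (Real.pi : ℂ) * Complex.I)).cexp
      have he : Function.Periodic.qParam 1 = fun w => Complex.exp (2 * Real.pi * Complex.I * w) := by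
        ext w
        simp [Function.Periodic.qParam]
      rw [hq, he]
      simpa using this
    have hc := (hgq.comp (τ : ℂ) hqp).congr_of_eventuallyEq hev
    rw [normalizedDerivOfComplex, hc.deriv]
    have := Complex.two_pi_I_ne_zero
    field_simp
  -- The term m = 0 vanishes; the remaining terms are q times the Taylor series of g′.
  rw [hD, ← hasSum_nat_add_iff' 1]
  convert! hsum.mul_left q using 1
  · ext m
    rw [qExpansion_coeff, iteratedDeriv_succ', Nat.factorial_succ]
    have : ((m : ℂ) + 1) ≠ 0 := by exact_mod_cast Nat.succ_ne_zero m
    simp only [smul_eq_mul, sub_zero]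
    push_cast
    field_simp
    ring
  · simp

theorem periodic_normalizedDerivOfComplex {F : ℍ → ℂ}
    (hper : Function.Periodic (F ∘ ofComplex) (1 : ℝ)) :
    Function.Periodic (normalizedDerivOfComplex F ∘ ofComplex) (1 : ℝ) := by
  have hshift : (F ∘ ofComplex) = (F ∘ ofComplex) ∘ (· + ((1 : ℝ) : ℂ)) :=
    funext fun z => (hper z).symm
  intro w
  by_cases hw : 0 < w.im
  · have hw' : 0 < (w + ((1 : ℝ) : ℂ)).im := by simpa using hw
    simp only [Function.comp_apply, normalizedDerivOfComplex, ofComplex_apply_of_im_pos hw,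
      ofComplex_apply_of_im_pos hw']
    conv_rhs => rw [hshift]
    rw [← deriv_comp_add_const]
    rfl
  -- Off the upper half-plane `ofComplex` takes a single default value, so periodicity is automatic
  -- there.
  · have hw' : (w + ((1 : ℝ) : ℂ)).im ≤ 0 := by simpa using hw
    rw [Function.comp_apply, Function.comp_apply, ofComplex_apply_of_im_nonpos hw',
      ofComplex_apply_of_im_nonpos (not_lt.mp hw)]

theorem periodic_E2 : Function.Periodic (E2 ∘ ofComplex) (1 : ℝ) := by
  intro w
  by_cases hw : 0 < w.im
  · have hw' : 0 < (w + ((1 : ℝ) : ℂ)).im := by simpa using hw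
    simp only [Function.comp_apply, ofComplex_apply_of_im_pos hw, ofComplex_apply_of_im_pos hw']
    refine (hasSum_qExpansion_E2 (z := ⟨_, hw'⟩)).unique ?_
    convert hasSum_qExpansion_E2 (z := ⟨w, hw⟩) using 4
    simp [mul_add, Complex.exp_add]
  · have hw' : (w + ((1 : ℝ) : ℂ)).im ≤ 0 := by simpa using hw
    rw [Function.comp_apply, Function.comp_apply, ofComplex_apply_of_im_nonpos hw',
      ofComplex_apply_of_im_nonpos (not_lt.mp hw)]

theorem analyticAt_cuspFunction_E2 : AnalyticAt ℂ (cuspFunction 1 E2) 0 :=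
  analyticAt_cuspFunction_zero one_pos periodic_E2 E2_mdifferentiable isBoundedAtImInfty_E2

/-- Uniqueness of the power series at 0. It serves E₂ and the normalized derivatives, which are not
modular forms. -/
theorem coeff_qExpansion_of_hasSum {f : ℍ → ℂ} (c : ℕ → ℂ)
    (hf : AnalyticAt ℂ (cuspFunction 1 f) 0)
    (hsum : ∀ τ : ℍ, HasSum (fun m => c m • Function.Periodic.qParam 1 τ ^ m) (f τ)) (m : ℕ) :
    (qExpansion 1 f).coeff m = c m := by
  have h1 := (hasFPowerSeriesOnBall_cuspFunction one_pos hf hsum).hasFPowerSeriesAt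
  have h2 : HasFPowerSeriesAt (cuspFunction 1 f)
      (FormalMultilinearSeries.ofScalars ℂ fun m => (qExpansion 1 f).coeff m) 0 := by
    simpa [qExpansion_coeff, div_eq_mul_inv, mul_comm] using hf.hasFPowerSeriesAt
  simpa using congr_arg (FormalMultilinearSeries.coeff · m) (h2.eq_formalMultilinearSeries h1)

theorem qExpansion_E2_coeff (m : ℕ) : (qExpansion 1 E2).coeff m =
    if m = 0 then 1 else -24 * (ArithmeticFunction.sigma 1 m : ℂ) :=
  coeff_qExpansion_of_hasSum (fun m => if m = 0 then 1 else -24 * (ArithmeticFunction.sigma 1 m : ℂ))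
    analyticAt_cuspFunction_E2 (fun τ => by
      simpa only [Function.Periodic.qParam, Complex.ofReal_one, div_one]
        using hasSum_qExpansion_E2 (z := τ)) m

/-! ### The Serre derivative in level one -/

section SerreDerivative

variable {k : ℤ} (F : ModularForm 𝒮ℒ k)

theorem isBoundedAtImInfty_levelOne : IsBoundedAtImInfty F :=
  have : Fact (IsCusp OnePoint.infty 𝒮ℒ) :=
    ⟨Subgroup.isCusp_of_mem_strictPeriods one_pos one_mem_strictPeriods_SL⟩
  ModularFormClass.bdd_at_infty F

theorem periodic_levelOne : Function.Periodic (F ∘ ofComplex) (1 : ℝ) :=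
  SlashInvariantFormClass.periodic_comp_ofComplex F one_mem_strictPeriods_SL

theorem isBoundedAtImInfty_normalizedDerivOfComplex :
    IsBoundedAtImInfty (normalizedDerivOfComplex F) :=
  isBoundedAtImInfty_of_hasSum_qExpansion one_pos
    (hasSum_normalizedDerivOfComplex (periodic_levelOne F) F.holo' (isBoundedAtImInfty_levelOne F))

theorem serreDerivative_eq_sub_smul :
    serreDerivative k F = normalizedDerivOfComplex F - ((k : ℂ) * 12⁻¹) • (E2 * F) := by
  ext z
  simp [mul_assoc]

theorem isBoundedAtImInfty_serreDerivative : IsBoundedAtImInfty (serreDerivative k F) := by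
  rw [serreDerivative_eq_sub_smul]
  exact (isBoundedAtImInfty_normalizedDerivOfComplex F).sub
    ((isBoundedAtImInfty_E2.mul (isBoundedAtImInfty_levelOne F)).smul _)

/-- The Serre derivative of a modular form of level one. -/
noncomputable def serreDerivativeForm : ModularForm 𝒮ℒ (k + 2) where
  toFun := serreDerivative k F
  slash_action_eq' A hA := by
    obtain ⟨A, rfl⟩ := hA
    exact serreDerivative_slash_invariant F.holo' (F.slash_action_eq' _ ⟨A, rfl⟩)
  holo' := serreDerivative_mdifferentiable _ F.holo'
  bdd_at_cusps' hc := by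
    rw [Subgroup.IsArithmetic.isCusp_iff_isCusp_SL2Z] at hc
    rw [OnePoint.isBoundedAt_iff_forall_SL2Z hc]
    -- Every cusp is an SL₂(ℤ)-translate of ∞, and slashing by γ gives back the Serre derivative, so
    -- boundedness at ∞ suffices.
    intro γ _
    have := serreDerivative_slash_invariant F.holo' (F.slash_action_eq' _ ⟨γ, rfl⟩)
    change IsBoundedAtImInfty (serreDerivative k F.toSlashInvariantForm ∣[k + 2] γ)
    rw [this]
    exact isBoundedAtImInfty_serreDerivative F

theorem qExpansion_serreDerivativeForm_coeff (m : ℕ) :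
    (qExpansion 1 (serreDerivativeForm F)).coeff m = m * (qExpansion 1 F).coeff m -
      k * 12⁻¹ * (qExpansion 1 E2 * qExpansion 1 F).coeff m := by
  have hF : AnalyticAt ℂ (cuspFunction 1 F) 0 :=
    ModularFormClass.analyticAt_cuspFunction_zero F one_pos one_mem_strictPeriods_SL
  have hD : AnalyticAt ℂ (cuspFunction 1 (normalizedDerivOfComplex F)) 0 :=
    analyticAt_cuspFunction_zero one_pos (periodic_normalizedDerivOfComplex (periodic_levelOne F))
      (normalizedDerivOfComplex_mdifferentiable F.holo')
      (isBoundedAtImInfty_normalizedDerivOfComplex F)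
  have hP : AnalyticAt ℂ (cuspFunction 1 (E2 * F)) 0 := by
    rw [cuspFunction_mul analyticAt_cuspFunction_E2.continuousAt hF.continuousAt]
    exact analyticAt_cuspFunction_E2.mul hF
  have hS : AnalyticAt ℂ (cuspFunction 1 (((k : ℂ) * 12⁻¹) • (E2 * ⇑F))) 0 := by
    rw [cuspFunction_smul hP.continuousAt]
    exact hP.const_smul
  change (qExpansion 1 (serreDerivative k F)).coeff m = _
  rw [serreDerivative_eq_sub_smul, qExpansion_sub hD hS, qExpansion_smul hP,
    qExpansion_mul analyticAt_cuspFunction_E2 hF, map_sub, PowerSeries.coeff_smul, smul_eq_mul,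
    coeff_qExpansion_of_hasSum (fun m => (m : ℂ) * (qExpansion 1 F).coeff m) hD
      (hasSum_normalizedDerivOfComplex (periodic_levelOne F) F.holo' (isBoundedAtImInfty_levelOne F))]

end SerreDerivative

/-- The Sturm bound applied to F - G: weights 6 and 8 need only the constant term, weight 18 also
the coefficient of q. -/
theorem ModularForm.qExpansion_eq_of_coeff_eq {k : ℤ} (F G : ModularForm 𝒮ℒ k)
    (h : ∀ m ≤ k.toNat / 12, (qExpansion 1 F).coeff m = (qExpansion 1 G).coeff m) :
    qExpansion 1 F = qExpansion 1 G := by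
  have hsub : qExpansion 1 (F - G : ModularForm 𝒮ℒ k) = qExpansion 1 F - qExpansion 1 G := by
    rw [FunLike.coe_sub, ModularForm.qExpansion_sub one_pos one_mem_strictPeriods_SL]
  have h0 : F - G = 0 := by
    refine sturm_bound_levelOne (lt_of_lt_of_le ?_
      (PowerSeries.nat_le_order _ (k.toNat / 12 + 1) fun i hi => ?_))
    · exact_mod_cast Nat.lt_succ_self _
    · rw [hsub, map_sub, h i (by omega), sub_self]
  rw [sub_eq_zero.mp h0]

/-! ### Ramanujan's differential equations over ℤ -/

/-- `E₂ = 1 - 24 ∑_{n ≥ 1} σ₁(n) q^n`. -/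
noncomputable def eisensteinTwo : PowerSeries ℤ :=
  PowerSeries.mk fun n => if n = 0 then 1 else -24 * (ArithmeticFunction.sigma 1 n : ℤ)

/-- `E₄ = 1 + 240 ∑_{n ≥ 1} σ₃(n) q^n`. -/
noncomputable def eisensteinFour : PowerSeries ℤ :=
  PowerSeries.mk fun n => if n = 0 then 1 else 240 * (ArithmeticFunction.sigma 3 n : ℤ)

theorem map_eisensteinTwo :
    eisensteinTwo.map (Int.castRingHom ℂ) = qExpansion 1 E2 := by
  ext m
  rw [qExpansion_E2_coeff]
  simp [eisensteinTwo, apply_ite (Int.cast : ℤ → ℂ)]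

theorem map_eisensteinFour :
    eisensteinFour.map (Int.castRingHom ℂ) = qExpansion 1 E₄ := by
  ext m
  rw [E_qExpansion_coeff _ ⟨2, rfl⟩, show bernoulli 4 = -1 / 30 by decide +kernel]
  norm_num [eisensteinFour, apply_ite (Int.cast : ℤ → ℂ)]

theorem map_eisensteinSix :
    eisensteinSix.map (Int.castRingHom ℂ) = qExpansion 1 E₆ := by
  ext m
  rw [E_qExpansion_coeff _ ⟨3, rfl⟩, show bernoulli 6 = 1 / 42 by decide +kernel]
  norm_num [eisensteinSix, apply_ite (Int.cast : ℤ → ℂ)]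

/-- The derivation `q d/dq` of formal power series. -/
noncomputable def qDeriv (A : Type*) [CommRing A] :
    Derivation A (PowerSeries A) (PowerSeries A) :=
  (PowerSeries.X : PowerSeries A) • PowerSeries.derivative A

@[simp]
theorem coeff_qDeriv {A : Type*} [CommRing A] (f : PowerSeries A) (n : ℕ) :
    (qDeriv A f).coeff n = n * f.coeff n := by
  cases n with
  | zero => simp [qDeriv]
  | succ n =>
    simp [qDeriv, PowerSeries.coeff_succ_X_mul, PowerSeries.coeff_derivative, mul_comm]

theorem qDeriv_map {A B : Type*} [CommRing A] [CommRing B] (φ : A →+* B) (f : PowerSeries A) :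
    qDeriv B (f.map φ) = (qDeriv A f).map φ := by
  ext n
  simp

theorem qExpansion_serreDerivativeForm {k : ℤ} (F : ModularForm 𝒮ℒ k) :
    qExpansion 1 (serreDerivativeForm F) = qDeriv ℂ (qExpansion 1 F) -
      ((k : ℂ) * 12⁻¹) • (qExpansion 1 E2 * qExpansion 1 F) := by
  ext m
  rw [qExpansion_serreDerivativeForm_coeff]
  simp

theorem coeff_zero_qExpansion_serreDerivativeForm {k : ℤ} (F : ModularForm 𝒮ℒ k) :
    (qExpansion 1 (serreDerivativeForm F)).coeff 0 = -(k * 12⁻¹ * (qExpansion 1 F).coeff 0) := by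
  have : (qExpansion 1 E2).coeff 0 = 1 := by simpa using qExpansion_E2_coeff 0
  rw [qExpansion_serreDerivativeForm_coeff, PowerSeries.coeff_mul]
  simp [this]

theorem map_castRingHom_complex_injective :
    Function.Injective (PowerSeries.map (Int.castRingHom ℂ)) :=
  PowerSeries.map_injective _ Int.cast_injective

/-- The Serre derivative of E₄ has weight 6 and constant term -4/12, hence equals -E₆/3. -/
theorem qDeriv_eisensteinFour :
    3 * qDeriv ℤ eisensteinFour = eisensteinTwo * eisensteinFour - eisensteinSix := by
  have h : qExpansion 1 (serreDerivativeForm E₄) = qExpansion 1 ((-3⁻¹ : ℂ) • E₆) := by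
    refine qExpansion_eq_of_coeff_eq (k := 6) (serreDerivativeForm E₄) ((-3⁻¹ : ℂ) • E₆) ?_
    intro m hm
    obtain rfl : m = 0 := by simpa using hm
    rw [coeff_zero_qExpansion_serreDerivativeForm, FunLike.coe_smul,
      ModularForm.qExpansion_smul one_pos one_mem_strictPeriods_SL, PowerSeries.coeff_smul,
      E_qExpansion_coeff_zero _ ⟨2, rfl⟩, E_qExpansion_coeff_zero _ ⟨3, rfl⟩]
    norm_num
  rw [qExpansion_serreDerivativeForm,
    ModularForm.qExpansion_smul one_pos one_mem_strictPeriods_SL, ← map_eisensteinTwo,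
    ← map_eisensteinFour, ← map_eisensteinSix, qDeriv_map] at h
  apply map_castRingHom_complex_injective
  simp only [map_sub, map_mul, map_ofNat]
  simp only [PowerSeries.smul_eq_C_mul] at h
  have hC : (3 : PowerSeries ℂ) * PowerSeries.C 3⁻¹ = 1 := by
    rw [← map_ofNat (PowerSeries.C (R := ℂ)), ← map_mul]
    norm_num
  have hC' : PowerSeries.C (((4 : ℤ) : ℂ) * 12⁻¹) = PowerSeries.C (3⁻¹ : ℂ) := by norm_num
  rw [hC', map_neg] at h
  linear_combination 3 * h + (eisensteinTwo.map (Int.castRingHom ℂ) *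
    eisensteinFour.map (Int.castRingHom ℂ) - eisensteinSix.map (Int.castRingHom ℂ)) * hC

/-- The Serre derivative of E₆ has weight 8 and constant term -6/12, hence equals -E₄²/2. -/
theorem qDeriv_eisensteinSix :
    2 * qDeriv ℤ eisensteinSix = eisensteinTwo * eisensteinSix - eisensteinFour ^ 2 := by
  have h : qExpansion 1 (serreDerivativeForm E₆) = qExpansion 1 ((-2⁻¹ : ℂ) • E₄.mul E₄) := by
    refine qExpansion_eq_of_coeff_eq (k := 8) (serreDerivativeForm E₆) ((-2⁻¹ : ℂ) • E₄.mul E₄) ?_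
    intro m hm
    obtain rfl : m = 0 := by simpa using hm
    rw [coeff_zero_qExpansion_serreDerivativeForm, FunLike.coe_smul,
      ModularForm.qExpansion_smul one_pos one_mem_strictPeriods_SL,
      ModularForm.qExpansion_mul one_pos one_mem_strictPeriods_SL, PowerSeries.coeff_smul,
      PowerSeries.coeff_mul, Finset.Nat.antidiagonal_zero, Finset.sum_singleton,
      E_qExpansion_coeff_zero _ ⟨2, rfl⟩, E_qExpansion_coeff_zero _ ⟨3, rfl⟩]
    norm_num
  rw [qExpansion_serreDerivativeForm,
    ModularForm.qExpansion_smul one_pos one_mem_strictPeriods_SL,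
    ModularForm.qExpansion_mul one_pos one_mem_strictPeriods_SL, ← map_eisensteinTwo,
    ← map_eisensteinFour, ← map_eisensteinSix, qDeriv_map] at h
  apply map_castRingHom_complex_injective
  simp only [map_sub, map_mul, map_pow, map_ofNat]
  simp only [PowerSeries.smul_eq_C_mul] at h
  have hC : (2 : PowerSeries ℂ) * PowerSeries.C 2⁻¹ = 1 := by
    rw [← map_ofNat (PowerSeries.C (R := ℂ)), ← map_mul]
    norm_num
  have hC' : PowerSeries.C (((6 : ℤ) : ℂ) * 12⁻¹) = PowerSeries.C (2⁻¹ : ℂ) := by norm_num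
  rw [hC', map_neg] at h
  linear_combination 2 * h + (eisensteinTwo.map (Int.castRingHom ℂ) *
    eisensteinSix.map (Int.castRingHom ℂ) - eisensteinFour.map (Int.castRingHom ℂ) ^ 2) * hC

/-! ### The Eisenstein series of weight 18 -/

/-- `43867 E₁₈`, as a power series with integral coefficients. -/
noncomputable def eisensteinEighteen : PowerSeries ℤ :=
  PowerSeries.mk fun n => if n = 0 then 43867 else -28728 * (ArithmeticFunction.sigma 17 n : ℤ)

/-- Gives -36/B₁₈ = -28728/43867. Here 19 divides 28728 = 36·798 but not 43867, which is why E₁₈ is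
constant modulo 19. -/
theorem bernoulli_eighteen : bernoulli 18 = 43867 / 798 := by
  have h0 (n : ℕ) (hn : Odd n) (h1 : 1 < n) : bernoulli' n = 0 :=
    bernoulli'_eq_zero_of_odd hn h1
  have h5 := h0 5 (by decide) (by norm_num)
  have h7 := h0 7 (by decide) (by norm_num)
  have h9 := h0 9 (by decide) (by norm_num)
  have h11 := h0 11 (by decide) (by norm_num)
  have h13 := h0 13 (by decide) (by norm_num)
  have h15 := h0 15 (by decide) (by norm_num)
  have h17 := h0 17 (by decide) (by norm_num)
  have h6 : bernoulli' 6 = 1 / 42 := by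
    rw [bernoulli'_def]
    norm_num [Finset.sum_range_succ, Nat.choose, h5]
  have h8 : bernoulli' 8 = -1 / 30 := by
    rw [bernoulli'_def]
    norm_num [Finset.sum_range_succ, Nat.choose, h5, h6, h7]
  have h10 : bernoulli' 10 = 5 / 66 := by
    rw [bernoulli'_def]
    norm_num [Finset.sum_range_succ, Nat.choose, h5, h6, h7, h8, h9]
  have h12 : bernoulli' 12 = -691 / 2730 := by
    rw [bernoulli'_def]
    norm_num [Finset.sum_range_succ, Nat.choose, h5, h6, h7, h8, h9, h10, h11]
  have h14 : bernoulli' 14 = 7 / 6 := by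
    rw [bernoulli'_def]
    norm_num [Finset.sum_range_succ, Nat.choose, h5, h6, h7, h8, h9, h10, h11, h12, h13]
  have h16 : bernoulli' 16 = -3617 / 510 := by
    rw [bernoulli'_def]
    norm_num [Finset.sum_range_succ, Nat.choose, h5, h6, h7, h8, h9, h10, h11, h12, h13, h14, h15]
  rw [bernoulli_eq_bernoulli'_of_ne_one (by norm_num), bernoulli'_def]
  norm_num [Finset.sum_range_succ, Nat.choose, h5, h6, h7, h8, h9, h10, h11, h12, h13, h14, h15,
    h16, h17]

theorem map_eisensteinEighteen : eisensteinEighteen.map (Int.castRingHom ℂ) =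
    (43867 : ℂ) • qExpansion 1 (E (k := 18) (by norm_num)) := by
  ext m
  rw [PowerSeries.coeff_smul, E_qExpansion_coeff _ ⟨9, rfl⟩,
    bernoulli_eighteen]
  rcases eq_or_ne m 0 with rfl | hm
  · simp [eisensteinEighteen]
  · simp only [eisensteinEighteen, PowerSeries.coeff_map, PowerSeries.coeff_mk, if_neg hm]
    push_cast [Int.coe_castRingHom, eq_intCast, smul_eq_mul]
    ring

theorem eisensteinEighteen_eq :
    eisensteinEighteen = 38367 * eisensteinFour ^ 3 * eisensteinSix + 5500 * eisensteinSix ^ 3 := by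
  set F : ModularForm 𝒮ℒ 18 := (43867 : ℂ) • E (k := 18) (by norm_num)
  set G : ModularForm 𝒮ℒ 18 := (38367 : ℂ) • ModularForm.mcast (by norm_num) ((E₄.pow 3).mul E₆) +
    (5500 : ℂ) • ModularForm.mcast (by norm_num) (E₆.pow 3)
  have hF : qExpansion 1 F = eisensteinEighteen.map (Int.castRingHom ℂ) := by
    rw [map_eisensteinEighteen, ← ModularForm.qExpansion_smul one_pos one_mem_strictPeriods_SL]
    rfl
  have hG : qExpansion 1 G = (38367 * eisensteinFour ^ 3 * eisensteinSix +
      5500 * eisensteinSix ^ 3).map (Int.castRingHom ℂ) := by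
    rw [FunLike.coe_add, ModularForm.qExpansion_add one_pos one_mem_strictPeriods_SL,
      FunLike.coe_smul, FunLike.coe_smul,
      ModularForm.qExpansion_smul one_pos one_mem_strictPeriods_SL,
      ModularForm.qExpansion_smul one_pos one_mem_strictPeriods_SL, coe_mcast, coe_mcast,
      ModularForm.qExpansion_mul one_pos one_mem_strictPeriods_SL,
      ModularForm.qExpansion_pow one_pos one_mem_strictPeriods_SL,
      ModularForm.qExpansion_pow one_pos one_mem_strictPeriods_SL, ← map_eisensteinFour,
      ← map_eisensteinSix]
    simp only [PowerSeries.smul_eq_C_mul, map_add, map_mul, map_pow, map_ofNat]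
    ring
  apply map_castRingHom_complex_injective
  rw [← hF, ← hG]
  refine qExpansion_eq_of_coeff_eq F G fun m hm => ?_
  rw [hF, hG, PowerSeries.coeff_map, PowerSeries.coeff_map]
  congr 1
  have h0 (c : ℕ) [c.AtLeastTwo] :
      PowerSeries.constantCoeff (OfNat.ofNat c : PowerSeries ℤ) = OfNat.ofNat c := map_ofNat _ c
  have h1 (c : ℕ) [c.AtLeastTwo] : (OfNat.ofNat c : PowerSeries ℤ).coeff 1 = 0 := by
    rw [← map_ofNat (PowerSeries.C (R := ℤ)), PowerSeries.coeff_C, if_neg one_ne_zero]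
  -- These two coefficients determine 38367 and 5500: 38367 + 5500 = 43867 and 38367·(720 - 504) -
  -- 5500·1512 = -28728.
  obtain rfl | rfl : m = 0 ∨ m = 1 := by
    have : m ≤ 1 := by simpa using hm
    omega
  all_goals
    simp [eisensteinEighteen, eisensteinFour, eisensteinSix, pow_succ, PowerSeries.coeff_mul,
      Finset.Nat.antidiagonal_succ, h0, h1]

end LevelOneForms

/-! ### Euler's product and the discriminant -/

theorem eulerProductPow_eq_pow (r : ℕ) : eulerProductPow r = eulerProductPow 1 ^ r := by
  have h := (hasProd_eulerProductPow 1).map (powMonoidHom r) (continuous_pow r)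
  refine (hasProd_eulerProductPow r).unique ?_
  simpa [Function.comp_def] using h

theorem hasProd_eulerProductPow_one :
    HasProd (fun n : ℕ => (1 : PowerSeries ℤ) - PowerSeries.X ^ (n + 1)) (eulerProductPow 1) := by
  simpa using hasProd_eulerProductPow 1

/-- The Lambert series `∑_{j ≥ 1} m q^{mj}`. -/
noncomputable def lambertTerm (m : ℕ) : PowerSeries ℤ :=
  PowerSeries.mk fun n => if m ∣ n ∧ n ≠ 0 then (m : ℤ) else 0

theorem qDeriv_one_sub_X_pow {m : ℕ} (hm : m ≠ 0) :
    qDeriv ℤ (1 - PowerSeries.X ^ m) = -lambertTerm m * (1 - PowerSeries.X ^ m) := by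
  ext n
  rw [mul_sub, mul_one, neg_mul, sub_neg_eq_add, map_add, map_neg, PowerSeries.coeff_mul_X_pow']
  simp only [coeff_qDeriv, lambertTerm, PowerSeries.coeff_mk, map_sub, PowerSeries.coeff_X_pow,
    PowerSeries.coeff_one]
  rcases eq_or_ne n 0 with rfl | hn
  · simp [hm]
  rcases lt_trichotomy n m with h | rfl | h
  · have : ¬ m ∣ n := fun hd => absurd (Nat.le_of_dvd (Nat.pos_of_ne_zero hn) hd) (by omega)
    simp [this, h.ne, hn, not_le.mpr h]
  · simp [hn]
  · have hd : m ∣ n - m ↔ m ∣ n := by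
      rw [Nat.dvd_sub_iff_left h.le dvd_rfl]
    simp [hd, hn, h.ne', h.le, Nat.sub_ne_zero_of_lt h]

theorem qDeriv_prod_one_sub_X_pow (s : Finset ℕ) :
    qDeriv ℤ (∏ n ∈ s, (1 - PowerSeries.X ^ (n + 1))) =
      -(∑ n ∈ s, lambertTerm (n + 1)) * ∏ n ∈ s, (1 - PowerSeries.X ^ (n + 1)) := by
  induction s using Finset.induction_on with
  | empty => simp
  | insert a s ha ih =>
    rw [Finset.prod_insert ha, Finset.sum_insert ha, Derivation.leibniz, ih,
      qDeriv_one_sub_X_pow (Nat.add_one_ne_zero a), smul_eq_mul, smul_eq_mul]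
    ring

/-- `∑_{n ≥ 1} σ₁(n) q^n`. -/
noncomputable def sigmaOneSeries : PowerSeries ℤ :=
  PowerSeries.mk fun n => (ArithmeticFunction.sigma 1 n : ℤ)

theorem coeff_sum_lambertTerm {s : Finset ℕ} {d i : ℕ} (hs : Finset.range d ⊆ s) (hi : i ≤ d) :
    (∑ n ∈ s, lambertTerm (n + 1)).coeff i = sigmaOneSeries.coeff i := by
  rcases eq_or_ne i 0 with rfl | h0
  · simp [lambertTerm, sigmaOneSeries]
  simp only [map_sum, lambertTerm, PowerSeries.coeff_mk, sigmaOneSeries, h0, ne_eq,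
    not_false_eq_true, and_true, ArithmeticFunction.sigma_one_apply]
  rw [← Finset.sum_filter]
  push_cast
  refine Finset.sum_bij (fun n _ => n + 1) ?_ ?_ ?_ ?_
  · intro n hn
    simpa [h0] using (Finset.mem_filter.mp hn).2
  · intro a _ b _ h
    simpa using h
  · intro b hb
    have hb1 := Nat.pos_of_mem_divisors hb
    have hb2 := Nat.divisor_le hb
    refine ⟨b - 1, ?_, by omega⟩
    rw [Finset.mem_filter, Nat.sub_add_cancel hb1]
    exact ⟨hs (Finset.mem_range.mpr (by omega)), Nat.dvd_of_mem_divisors hb⟩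
  · intro n _
    push_cast
    rfl

/-- The logarithmic derivative of a finite partial product is minus a sum of Lambert series. In each
degree d it suffices to take a partial product that contains the factors 1, …, d and agrees with the
infinite product up to q^d. -/
theorem qDeriv_eulerProductPow_one :
    qDeriv ℤ (eulerProductPow 1) = -sigmaOneSeries * eulerProductPow 1 := by
  ext d
  have hcoeff (i : ℕ) : ∀ᶠ s : Finset ℕ in Filter.atTop,
      (∏ n ∈ s, (1 - PowerSeries.X ^ (n + 1)) : PowerSeries ℤ).coeff i =
        (eulerProductPow 1).coeff i := by
    have h := hasProd_eulerProductPow_one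
    rw [HasProd, PowerSeries.WithPiTopology.tendsto_iff_coeff_tendsto] at h
    simpa using h i
  have hall : ∀ᶠ s : Finset ℕ in Filter.atTop, ∀ i ∈ Finset.range (d + 1),
      (∏ n ∈ s, (1 - PowerSeries.X ^ (n + 1)) : PowerSeries ℤ).coeff i =
        (eulerProductPow 1).coeff i :=
    (Filter.eventually_all_finset _).mpr fun i _ => hcoeff i
  obtain ⟨s, hs, hsd⟩ := (hall.and (Filter.eventually_ge_atTop (Finset.range d))).exists
  have h := congrArg (PowerSeries.coeff d) (qDeriv_prod_one_sub_X_pow s)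
  rw [coeff_qDeriv, hs d (by simp), neg_mul, map_neg, PowerSeries.coeff_mul] at h
  rw [coeff_qDeriv, h, neg_mul, map_neg, PowerSeries.coeff_mul]
  congr 1
  refine Finset.sum_congr rfl fun ij hij => ?_
  have := Finset.HasAntidiagonal.mem_antidiagonal.mp hij
  rw [coeff_sum_lambertTerm hsd (by omega), hs _ (Finset.mem_range.mpr (by omega))]

theorem eisensteinTwo_eq : eisensteinTwo = 1 - 24 * sigmaOneSeries := by
  ext n
  rw [show (24 : PowerSeries ℤ) = PowerSeries.C 24 from (map_ofNat _ _).symm, map_sub,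
    PowerSeries.coeff_C_mul, PowerSeries.coeff_one]
  rcases eq_or_ne n 0 with rfl | hn
  · simp [eisensteinTwo, sigmaOneSeries]
  · simp [eisensteinTwo, sigmaOneSeries, hn]

theorem qDeriv_X_mul_eulerProductPow_one_pow :
    qDeriv ℤ (PowerSeries.X * eulerProductPow 1 ^ 24) =
      eisensteinTwo * (PowerSeries.X * eulerProductPow 1 ^ 24) := by
  have hX : qDeriv ℤ PowerSeries.X = PowerSeries.X := by simp [qDeriv]
  rw [Derivation.leibniz, Derivation.leibniz_pow, hX, qDeriv_eulerProductPow_one, eisensteinTwo_eq]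
  simp only [smul_eq_mul, nsmul_eq_mul]
  push_cast
  ring

/-- A solution of `q df/dq = E₂ f` is determined by its coefficients of `1` and `q`. -/
theorem eq_zero_of_qDeriv_eq_eisensteinTwo_mul {f : PowerSeries ℤ}
    (hf : qDeriv ℤ f = eisensteinTwo * f) (h1 : f.coeff 1 = 0) : f = 0 := by
  ext n
  induction n using Nat.strong_induction_on with
  | _ n ih =>
    rcases eq_or_ne n 1 with rfl | hn
    · simpa using h1
    have h := congrArg (PowerSeries.coeff n) hf
    rw [coeff_qDeriv, PowerSeries.coeff_mul, Finset.sum_eq_single (0, n)] at h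
    -- As E₂ has constant term 1, the lower coefficients being zero leaves (n - 1)aₙ = 0.
    · have h2 : ((n : ℤ) - 1) * f.coeff n = 0 := by
        have : eisensteinTwo.coeff 0 = 1 := by simp [eisensteinTwo]
        rw [this] at h
        linear_combination h
      rcases mul_eq_zero.mp h2 with h3 | h3
      · omega
      · simpa using h3
    · rintro ⟨i, j⟩ hij hne
      have := Finset.HasAntidiagonal.mem_antidiagonal.mp hij
      have hj : j < n := by
        by_contra hj
        exact hne (by ext <;> simp <;> omega)
      rw [ih j hj]
      simp
    · simp

/-- Both sides solve θf = E₂f: the left by logarithmic differentiation, the right because 3E₄²·θE₄ -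
2E₆·θE₆ = E₄²(E₂E₄ - E₆) - E₆(E₂E₆ - E₄²). Their coefficients of q are both 1728. -/
theorem discriminant_eq_eulerProductPow :
    1728 * (PowerSeries.X * eulerProductPow 1 ^ 24) = eisensteinFour ^ 3 - eisensteinSix ^ 2 := by
  rw [← sub_eq_zero]
  apply eq_zero_of_qDeriv_eq_eisensteinTwo_mul
  · have h3 := qDeriv_eisensteinFour
    have h2 := qDeriv_eisensteinSix
    have hc : qDeriv ℤ (1728 : PowerSeries ℤ) = 0 := by
      rw [← map_ofNat (algebraMap ℤ (PowerSeries ℤ))]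
      exact Derivation.map_algebraMap _ _
    rw [map_sub, map_sub, Derivation.leibniz, hc, qDeriv_X_mul_eulerProductPow_one_pow,
      Derivation.leibniz_pow, Derivation.leibniz_pow]
    simp only [smul_eq_mul, nsmul_eq_mul]
    push_cast
    linear_combination (-eisensteinFour ^ 2) * h3 + eisensteinSix * h2
  · have hE : PowerSeries.constantCoeff (eulerProductPow 1) = 1 := by
      have h := hasProd_eulerProductPow_one.map (PowerSeries.constantCoeff (R := ℤ))
        (PowerSeries.WithPiTopology.continuous_constantCoeff ℤ)
      refine h.unique ?_
      simp [Function.comp_def, hasProd_one]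
    have h1 : (PowerSeries.X * eulerProductPow 1 ^ 24).coeff 1 = 1 := by
      rw [PowerSeries.coeff_succ_X_mul 0]
      simp [hE]
    rw [← map_ofNat (PowerSeries.C (R := ℤ)), map_sub, PowerSeries.coeff_C_mul, h1]
    simp [eisensteinFour, eisensteinSix, pow_succ, PowerSeries.coeff_mul,
      Finset.Nat.antidiagonal_succ]

/-! ### The generating function of partitions -/

theorem partitionCount_series_mul_eulerProductPow_one :
    (PowerSeries.mk fun n => (partitionCount n : ℤ)) * eulerProductPow 1 = 1 := by
  have h := Nat.Partition.hasProd_powerSeriesMk_card_restricted ℤ fun _ => True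
  have hp : (PowerSeries.mk fun n => ((Nat.Partition.restricted n fun _ => True).card : ℤ)) =
      PowerSeries.mk fun n => (partitionCount n : ℤ) := by
    simp [Nat.Partition.restricted, partitionCount]
  rw [hp] at h
  refine (h.mul hasProd_eulerProductPow_one).unique ?_
  convert! (hasProd_one : HasProd (fun _ : ℕ => (1 : PowerSeries ℤ)) 1) using 2 with i
  simp only [if_true, pow_mul]
  exact PowerSeries.WithPiTopology.tsum_pow_mul_one_sub_of_constantCoeff_eq_zero (by simp)

/-! ### Multisection of power series modulo p -/

theorem PowerSeries.expand_zmod_eq_pow (p : ℕ) [hp : Fact p.Prime] (f : PowerSeries (ZMod p)) :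
    PowerSeries.expand p hp.out.ne_zero f = f ^ p := by
  have h := MvPowerSeries.map_frobenius_expand p hp.out.ne_zero (f := f)
  rw [ZMod.frobenius_zmod, MvPowerSeries.map_id] at h
  exact h

/-- The power series `∑ a(pn + s) q^n` extracted from `∑ a(n) q^n`. -/
noncomputable def PowerSeries.multisection {A : Type*} [Semiring A] (p s : ℕ) (f : PowerSeries A) :
    PowerSeries A :=
  PowerSeries.mk fun n => f.coeff (p * n + s)

section Multisection

variable {p s : ℕ} [hp : Fact p.Prime]

/-- Since g^p = g(q^p) modulo p, this factor involves only exponents divisible by p and passes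
through the multisection as g. -/
theorem PowerSeries.multisection_mul_pow (hs : s < p) (f g : PowerSeries (ZMod p)) :
    (f * g ^ p).multisection p s = f.multisection p s * g := by
  ext n
  have hp0 : p ≠ 0 := hp.out.ne_zero
  rw [← PowerSeries.expand_zmod_eq_pow, PowerSeries.multisection, PowerSeries.coeff_mk,
    PowerSeries.coeff_mul, PowerSeries.coeff_mul]
  symm
  refine Finset.sum_of_injOn (fun ij => (p * ij.1 + s, p * ij.2)) ?_ ?_ ?_ ?_
  · rintro ⟨i, j⟩ _ ⟨i', j'⟩ _ h
    simpa [hp0] using h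
  · rintro ⟨i, j⟩ h
    have := Finset.HasAntidiagonal.mem_antidiagonal.mp (Finset.mem_coe.mp h)
    simp only at this
    refine Finset.mem_coe.mpr (Finset.HasAntidiagonal.mem_antidiagonal.mpr ?_)
    simp only
    rw [← this]
    ring
  · rintro ⟨i, j⟩ h hnot
    have hij := Finset.HasAntidiagonal.mem_antidiagonal.mp h
    simp only at hij ⊢
    by_cases hd : p ∣ j
    · obtain ⟨m, rfl⟩ := hd
      exfalso
      apply hnot
      have hm : m ≤ n := by
        by_contra! hm
        have : p * (n + 1) ≤ p * m := Nat.mul_le_mul_left p hm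
        rw [mul_add] at this
        omega
      obtain ⟨l, rfl⟩ := Nat.exists_eq_add_of_le hm
      refine ⟨(l, m), ?_, ?_⟩
      · simp [add_comm]
      · rw [mul_add] at hij
        ext
        · simp only
          omega
        · simp
    · rw [PowerSeries.coeff_expand_of_not_dvd p hp0 _ hd, mul_zero]
  · rintro ⟨i, j⟩ _
    simp [PowerSeries.multisection]

theorem PowerSeries.multisection_X_pow_mul_pow (hs : s < p) (g : PowerSeries (ZMod p)) :
    (PowerSeries.X ^ s * g ^ p).multisection p s = g := by
  rw [PowerSeries.multisection_mul_pow hs]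
  have : (PowerSeries.X ^ s : PowerSeries (ZMod p)).multisection p s = 1 := by
    ext n
    simp [PowerSeries.multisection, PowerSeries.coeff_X_pow, PowerSeries.coeff_one,
      hp.out.ne_zero]
  rw [this, one_mul]

/-- If `f` differs from `q^s g(q^p)` by an element of the image of `q d/dq - s`, then `g` is the
multisection of `f` at the residue `s`. -/
theorem PowerSeries.multisection_eq_of_sub_eq_qDeriv (hs : s < p) {f g w : PowerSeries (ZMod p)}
    (h : f - PowerSeries.X ^ s * g ^ p = qDeriv (ZMod p) w - (s : PowerSeries (ZMod p)) * w) :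
    f.multisection p s = g := by
  rw [← PowerSeries.multisection_X_pow_mul_pow hs g]
  ext n
  have hn := congrArg (PowerSeries.coeff (p * n + s)) h
  rw [map_sub, map_sub, coeff_qDeriv, ← map_natCast (PowerSeries.C (R := ZMod p)),
    PowerSeries.coeff_C_mul] at hn
  -- On q^(pn+s) the operator θ - s acts as pn, which is 0 modulo p.
  simp only [Nat.cast_add, Nat.cast_mul, CharP.cast_eq_zero, zero_mul, zero_add, sub_self] at hn
  simpa [PowerSeries.multisection] using sub_eq_zero.mp hn

end Multisection

/-! ### Reduction modulo 19: P, Q, R and θ -/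

instance fact_prime_nineteen : Fact (Nat.Prime 19) := ⟨by norm_num⟩

instance charP_powerSeries_zmod_nineteen : CharP (PowerSeries (ZMod 19)) 19 :=
  charP_of_injective_algebraMap (R := ZMod 19) PowerSeries.C_injective 19

theorem nineteen_eq_zero : (19 : PowerSeries (ZMod 19)) = 0 := by
  rw [← map_ofNat (PowerSeries.C (R := ZMod 19))]
  simp [show (19 : ZMod 19) = 0 from rfl]

section PolynomialIdentities

variable {S : Type*} [CommRing S] [CharP S 19]

/-- Division by 15: modulo 19, 38367 ≡ 6 ≡ 15·8 and 5500 ≡ 9 ≡ 15·12. -/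
theorem unit_of_weight_eighteen_relation {q r : S}
    (h : 15 = 38367 * q ^ 3 * r + 5500 * r ^ 3) : r * (8 * q ^ 3 + 12 * r ^ 2) = 1 := by
  grind

/-- The hypothesis `h` is θA = 0 expanded by Ramanujan's equations, with 13 = 1/3 and 10 = 1/2. Its
part linear in P is 11·P·A = 11·P, so P can be solved for. -/
theorem weight_two_eq_of_unit {p q r : S}
    (hA : r * (8 * q ^ 3 + 12 * r ^ 2) = 1)
    (h : r * (8 * (3 * (q ^ 2 * (13 * (p * q - r)))) + 12 * (2 * (r * (10 * (p * r - q ^ 2))))) +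
      (8 * q ^ 3 + 12 * r ^ 2) * (10 * (p * r - q ^ 2)) = 0) :
    p = 11 * q ^ 2 * r ^ 2 + 9 * q ^ 5 := by
  grind

/-- Multiplying the lone r by A = 1 raises its weight from 6 to 24, that of the other terms; the
result is isobaric and factors. The formula for θR below arises likewise, in weight 26. -/
theorem deriv_four_eq_of_unit {q r : S}
    (hA : r * (8 * q ^ 3 + 12 * r ^ 2) = 1) :
    13 * ((11 * q ^ 2 * r ^ 2 + 9 * q ^ 5) * q - r) = (q ^ 3 - r ^ 2) * (3 * q ^ 3 + 4 * r ^ 2) := by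
  grind

theorem deriv_six_eq_of_unit {q r : S}
    (hA : r * (8 * q ^ 3 + 12 * r ^ 2) = 1) :
    10 * ((11 * q ^ 2 * r ^ 2 + 9 * q ^ 5) * r - q ^ 2) = 10 * q ^ 2 * r * (q ^ 3 - r ^ 2) := by
  grind

end PolynomialIdentities

section ModNineteen

local notation "θ" => qDeriv (ZMod 19)

/-- The reduction modulo `19` of a power series with integral coefficients. -/
noncomputable def modNineteen : PowerSeries ℤ →+* PowerSeries (ZMod 19) :=
  PowerSeries.map (Int.castRingHom (ZMod 19))

local notation "Pₘ" => modNineteen eisensteinTwo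
local notation "Qₘ" => modNineteen eisensteinFour
local notation "Rₘ" => modNineteen eisensteinSix
local notation "η" => modNineteen (eulerProductPow 1)

theorem qDeriv_modNineteen (f : PowerSeries ℤ) : θ (modNineteen f) = modNineteen (qDeriv ℤ f) :=
  qDeriv_map _ f

theorem eisensteinSix_unit_modNineteen : Rₘ * (8 * Qₘ ^ 3 + 12 * Rₘ ^ 2) = 1 := by
  have h := congrArg modNineteen eisensteinEighteen_eq
  have h18 : modNineteen eisensteinEighteen = 15 := by
    ext n
    rw [← map_ofNat (PowerSeries.C (R := ZMod 19)), PowerSeries.coeff_C]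
    simp only [modNineteen, eisensteinEighteen, PowerSeries.coeff_map, PowerSeries.coeff_mk]
    split_ifs
    · rfl
    · simp only [eq_intCast, Int.cast_mul]
      rw [show ((-28728 : ℤ) : ZMod 19) = 0 from rfl, zero_mul]
  rw [h18] at h
  simp only [map_add, map_mul, map_pow, map_ofNat] at h
  exact unit_of_weight_eighteen_relation h

theorem qDeriv_Q_modNineteen : θ Qₘ = 13 * (Pₘ * Qₘ - Rₘ) := by
  have h := congrArg modNineteen qDeriv_eisensteinFour
  simp only [map_mul, map_sub, map_ofNat, ← qDeriv_modNineteen] at h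
  linear_combination 13 * h - 2 * θ Qₘ * nineteen_eq_zero

theorem qDeriv_R_modNineteen : θ Rₘ = 10 * (Pₘ * Rₘ - Qₘ ^ 2) := by
  have h := congrArg modNineteen qDeriv_eisensteinSix
  simp only [map_mul, map_sub, map_pow, map_ofNat, ← qDeriv_modNineteen] at h
  linear_combination 10 * h - θ Rₘ * nineteen_eq_zero

theorem qDeriv_ofNat (n : ℕ) [n.AtLeastTwo] : θ ofNat(n) = 0 := by
  rw [← map_ofNat (algebraMap (ZMod 19) (PowerSeries (ZMod 19)))]
  exact Derivation.map_algebraMap _ _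

theorem eisensteinTwo_modNineteen : Pₘ = 11 * Qₘ ^ 2 * Rₘ ^ 2 + 9 * Qₘ ^ 5 := by
  have h := congrArg θ eisensteinSix_unit_modNineteen
  have hA := eisensteinSix_unit_modNineteen
  simp only [map_add, Derivation.leibniz, Derivation.leibniz_pow, Derivation.map_one_eq_zero,
    qDeriv_ofNat, qDeriv_Q_modNineteen, qDeriv_R_modNineteen, smul_eq_mul, nsmul_eq_mul] at h
  refine weight_two_eq_of_unit hA ?_
  push_cast at h
  linear_combination h

theorem qDeriv_Q_eq : θ Qₘ = (Qₘ ^ 3 - Rₘ ^ 2) * (3 * Qₘ ^ 3 + 4 * Rₘ ^ 2) := by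
  have hA := eisensteinSix_unit_modNineteen
  have h19 := nineteen_eq_zero
  rw [qDeriv_Q_modNineteen, eisensteinTwo_modNineteen]
  exact deriv_four_eq_of_unit eisensteinSix_unit_modNineteen

theorem qDeriv_R_eq : θ Rₘ = 10 * Qₘ ^ 2 * Rₘ * (Qₘ ^ 3 - Rₘ ^ 2) := by
  have hA := eisensteinSix_unit_modNineteen
  have h19 := nineteen_eq_zero
  rw [qDeriv_R_modNineteen, eisensteinTwo_modNineteen]
  exact deriv_six_eq_of_unit eisensteinSix_unit_modNineteen

/-- Logarithmic differentiation gives θη = (P - 1)η/24, and 1/24 = 4 modulo 19. -/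
theorem qDeriv_eulerProduct_modNineteen : θ η = 4 * (Pₘ - 1) * η := by
  have h := congrArg modNineteen qDeriv_eulerProductPow_one
  rw [qDeriv_modNineteen, h, eisensteinTwo_eq]
  simp only [map_mul, map_sub, map_neg, map_one, map_ofNat]
  linear_combination 5 * modNineteen sigmaOneSeries * η * nineteen_eq_zero

theorem discriminant_modNineteen : PowerSeries.X * η ^ 24 = Rₘ ^ 2 - Qₘ ^ 3 := by
  have h := congrArg modNineteen discriminant_eq_eulerProductPow
  have hX : modNineteen PowerSeries.X = PowerSeries.X := PowerSeries.map_X _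
  simp only [map_mul, map_sub, map_pow, map_ofNat, hX] at h
  -- 1728 = 91·19 - 1.
  linear_combination -h + 91 * PowerSeries.X * η ^ 24 * nineteen_eq_zero

/-- θη^r = 4r(P - 1)η^r, and the summand -4r cancels -s modulo 19. The power of η thus factors out
of θ - s, leaving a weight-raising operator on w. -/
theorem qDeriv_eulerProduct_pow_mul_sub (r s m : ℕ) (h : s + 4 * r = 19 * m)
    (w : PowerSeries (ZMod 19)) :
    θ (η ^ r * w) - (s : PowerSeries (ZMod 19)) * (η ^ r * w) = η ^ r * (θ w + 4 * r * Pₘ * w) := by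
  have hs : (s : PowerSeries (ZMod 19)) + 4 * r = 0 := by
    have := congrArg (Nat.cast (R := PowerSeries (ZMod 19))) h
    push_cast at this
    rw [this, nineteen_eq_zero, zero_mul]
  rw [Derivation.leibniz, Derivation.leibniz_pow, qDeriv_eulerProduct_modNineteen]
  simp only [smul_eq_mul, nsmul_eq_mul]
  rcases r with _ | r
  · simp only [pow_zero, Nat.cast_zero] at hs ⊢
    linear_combination -w * hs
  · rw [Nat.add_sub_cancel]
    linear_combination -(η ^ (r + 1) * w) * hs

/-! ### The three multisections modulo 19 -/

theorem multisection_four_eulerProduct_pow :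
    (η ^ 18).multisection 19 4 = 5 * (Rₘ * η ^ 6) := by
  -- An isobaric solution of weight 142 = 162 - 20 of the linear equation `key` over 𝔽₁₉.
  set w := Qₘ * Rₘ ^ 9 * (11 * Rₘ ^ 14 + 5 * Qₘ ^ 3 * Rₘ ^ 12 + 12 * Qₘ ^ 6 * Rₘ ^ 10 +
    9 * Qₘ ^ 9 * Rₘ ^ 8 + 13 * Qₘ ^ 12 * Rₘ ^ 6 + 13 * Qₘ ^ 15 * Rₘ ^ 4 + 5 * Qₘ ^ 18 * Rₘ ^ 2 +
    3 * Qₘ ^ 21) with hw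
  -- With g = 5Rη⁶, q⁴g¹⁹ = η¹⁸·5¹⁹R¹⁹(qη²⁴)⁴. The factor A⁹ = 1 has weight 162, that of R¹⁹(R² -
  -- Q³)⁴, so the equality already holds for independent variables q, r over 𝔽₁₉.
  have key : θ w + 72 * Pₘ * w =
      (Rₘ * (8 * Qₘ ^ 3 + 12 * Rₘ ^ 2)) ^ 9 - 5 ^ 19 * Rₘ ^ 19 * (Rₘ ^ 2 - Qₘ ^ 3) ^ 4 := by
    rw [hw]
    simp only [map_add, Derivation.leibniz, Derivation.leibniz_pow, qDeriv_ofNat, qDeriv_Q_eq,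
      qDeriv_R_eq, eisensteinTwo_modNineteen, smul_eq_mul, nsmul_eq_mul, mul_zero, add_zero]
    push_cast
    generalize Qₘ = q
    generalize Rₘ = r
    grind
  apply PowerSeries.multisection_eq_of_sub_eq_qDeriv (by norm_num) (w := η ^ 18 * w)
  rw [qDeriv_eulerProduct_pow_mul_sub 18 4 4 (by norm_num)]
  rw [eisensteinSix_unit_modNineteen, ← discriminant_modNineteen] at key
  push_cast
  linear_combination -η ^ 18 * key

theorem multisection_eighteen_eisensteinSix_mul :
    (Rₘ * η ^ 24).multisection 19 18 = 6 * (Rₘ * η ^ 24) := by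
  set w := Qₘ * Rₘ ^ 19 * (6 * Rₘ ^ 32 + 10 * Qₘ ^ 3 * Rₘ ^ 30 + 16 * Qₘ ^ 6 * Rₘ ^ 28 +
    16 * Qₘ ^ 9 * Rₘ ^ 26 + Qₘ ^ 12 * Rₘ ^ 24 + 9 * Qₘ ^ 15 * Rₘ ^ 22 + Qₘ ^ 18 * Rₘ ^ 20 +
    11 * Qₘ ^ 21 * Rₘ ^ 18 + 10 * Qₘ ^ 24 * Rₘ ^ 16 + 12 * Qₘ ^ 27 * Rₘ ^ 14 +
    3 * Qₘ ^ 30 * Rₘ ^ 12 + 11 * Qₘ ^ 33 * Rₘ ^ 10 + 12 * Qₘ ^ 36 * Rₘ ^ 8 +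
    11 * Qₘ ^ 39 * Rₘ ^ 6 + 16 * Qₘ ^ 42 * Rₘ ^ 4 + 14 * Qₘ ^ 45 * Rₘ ^ 2 + 13 * Qₘ ^ 48) with hw
  -- The same scheme with g = 6Rη²⁴: R·A¹⁸ and R¹⁹(R² - Q³)¹⁸ have weight 330, and w has weight 310.
  have key : θ w + 96 * Pₘ * w =
      Rₘ * (Rₘ * (8 * Qₘ ^ 3 + 12 * Rₘ ^ 2)) ^ 18 -
        6 ^ 19 * Rₘ ^ 19 * (Rₘ ^ 2 - Qₘ ^ 3) ^ 18 := by
    rw [hw]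
    simp only [map_add, Derivation.leibniz, Derivation.leibniz_pow, qDeriv_ofNat, qDeriv_Q_eq,
      qDeriv_R_eq, eisensteinTwo_modNineteen, smul_eq_mul, nsmul_eq_mul, mul_zero, add_zero]
    push_cast
    generalize Qₘ = q
    generalize Rₘ = r
    grind
  apply PowerSeries.multisection_eq_of_sub_eq_qDeriv (by norm_num) (w := η ^ 24 * w)
  rw [qDeriv_eulerProduct_pow_mul_sub 24 18 6 (by norm_num)]
  rw [eisensteinSix_unit_modNineteen, ← discriminant_modNineteen] at key
  push_cast
  linear_combination -η ^ 24 * key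

theorem multisection_three_eisensteinSix_mul :
    (Rₘ * η ^ 42).multisection 19 3 = 8 * (Rₘ * η ^ 6) := by
  set w := Qₘ * Rₘ ^ 9 * (4 * Rₘ ^ 12 + 4 * Qₘ ^ 3 * Rₘ ^ 10 + 14 * Qₘ ^ 12 * Rₘ ^ 4 +
    5 * Qₘ ^ 15 * Rₘ ^ 2 + 17 * Qₘ ^ 18) with hw
  -- The same scheme with g = 8Rη⁶: R·A⁸ and R¹⁹(R² - Q³)³ have weight 150, and w has weight 130.
  have key : θ w + 168 * Pₘ * w =
      Rₘ * (Rₘ * (8 * Qₘ ^ 3 + 12 * Rₘ ^ 2)) ^ 8 -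
        8 ^ 19 * Rₘ ^ 19 * (Rₘ ^ 2 - Qₘ ^ 3) ^ 3 := by
    rw [hw]
    simp only [map_add, Derivation.leibniz, Derivation.leibniz_pow, qDeriv_ofNat, qDeriv_Q_eq,
      qDeriv_R_eq, eisensteinTwo_modNineteen, smul_eq_mul, nsmul_eq_mul, mul_zero, add_zero]
    push_cast
    generalize Qₘ = q
    generalize Rₘ = r
    grind
  apply PowerSeries.multisection_eq_of_sub_eq_qDeriv (by norm_num) (w := η ^ 42 * w)
  rw [qDeriv_eulerProduct_pow_mul_sub 42 3 9 (by norm_num)]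
  rw [eisensteinSix_unit_modNineteen, ← discriminant_modNineteen] at key
  push_cast
  linear_combination -η ^ 42 * key

end ModNineteen

/-! ### Recursions modulo 19 and the congruences -/

section PartitionCongruences

local notation "Rₘ" => modNineteen eisensteinSix
local notation "η" => modNineteen (eulerProductPow 1)

/-- The generating function of the partition function modulo `19`. -/
noncomputable def partitionSeries : PowerSeries (ZMod 19) :=
  PowerSeries.mk fun n => (partitionCount n : ZMod 19)

theorem partitionSeries_mul_eulerProduct : partitionSeries * η = 1 := by
  have h := congrArg modNineteen partitionCount_series_mul_eulerProductPow_one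
  rw [map_mul, map_one] at h
  have hp : partitionSeries = modNineteen (PowerSeries.mk fun n => (partitionCount n : ℤ)) := by
    ext n
    simp [partitionSeries, modNineteen]
  rw [hp, h]

theorem isUnit_eulerProduct : IsUnit η := .of_mul_eq_one_right _ partitionSeries_mul_eulerProduct

/-- Multiplying by η¹⁹ = η(q¹⁹) turns 1/η, Rη⁵ and Rη²³ into the series η¹⁸, Rη²⁴ and Rη⁴² treated
above; the resulting factor η is a unit and cancels. -/
theorem multisection_eq_of_mul_eulerProduct_pow {s : ℕ} (hs : s < 19)
    {f g : PowerSeries (ZMod 19)} (h : (f * η ^ 19).multisection 19 s = g * η) :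
    f.multisection 19 s = g := by
  rw [PowerSeries.multisection_mul_pow hs] at h
  exact isUnit_eulerProduct.mul_right_cancel h

theorem multisection_partitionSeries :
    partitionSeries.multisection 19 4 = 5 * (Rₘ * η ^ 5) := by
  apply multisection_eq_of_mul_eulerProduct_pow (by norm_num)
  have h : partitionSeries * η ^ 19 = η ^ 18 := by
    linear_combination η ^ 18 * partitionSeries_mul_eulerProduct
  rw [h, multisection_four_eulerProduct_pow]
  ring

theorem multisection_eisensteinSix_mul_pow_five :
    (Rₘ * η ^ 5).multisection 19 18 = 6 * (Rₘ * η ^ 23) := by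
  apply multisection_eq_of_mul_eulerProduct_pow (by norm_num)
  rw [mul_assoc, ← pow_add, multisection_eighteen_eisensteinSix_mul]
  ring

theorem multisection_eisensteinSix_mul_pow_twentythree :
    (Rₘ * η ^ 23).multisection 19 3 = 8 * (Rₘ * η ^ 5) := by
  apply multisection_eq_of_mul_eulerProduct_pow (by norm_num)
  rw [mul_assoc, ← pow_add, multisection_three_eisensteinSix_mul]
  ring

theorem coeff_modNineteen_five (n : ℕ) : (Rₘ * η ^ 5).coeff n = (coeffE n : ZMod 19) := by
  rw [coeffE, eulerProductPow_eq_pow 5, ← map_pow, ← map_mul, modNineteen, PowerSeries.coeff_map]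
  rfl

theorem coeff_modNineteen_twentythree (n : ℕ) :
    (Rₘ * η ^ 23).coeff n = (coeffF n : ZMod 19) := by
  rw [coeffF, eulerProductPow_eq_pow 23, ← map_pow, ← map_mul, modNineteen, PowerSeries.coeff_map]
  rfl

theorem coeff_ofNat_mul (c n : ℕ) [c.AtLeastTwo] (f : PowerSeries (ZMod 19)) :
    (ofNat(c) * f).coeff n = ofNat(c) * f.coeff n := by
  rw [← map_ofNat (PowerSeries.C (R := ZMod 19)), PowerSeries.coeff_C_mul]

theorem partitionCount_nineteen (n : ℕ) :
    (partitionCount (19 * n + 4) : ZMod 19) = 5 * (coeffE n : ZMod 19) := by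
  have h := congrArg (PowerSeries.coeff n) multisection_partitionSeries
  rw [coeff_ofNat_mul, coeff_modNineteen_five] at h
  simpa [PowerSeries.multisection, partitionSeries] using h

theorem coeffE_nineteen (n : ℕ) : (coeffE (19 * n + 18) : ZMod 19) = 6 * (coeffF n : ZMod 19) := by
  have h := congrArg (PowerSeries.coeff n) multisection_eisensteinSix_mul_pow_five
  rwa [coeff_ofNat_mul, coeff_modNineteen_twentythree, PowerSeries.multisection,
    PowerSeries.coeff_mk, coeff_modNineteen_five] at h

theorem coeffF_nineteen (n : ℕ) : (coeffF (19 * n + 3) : ZMod 19) = 8 * (coeffE n : ZMod 19) := by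
  have h := congrArg (PowerSeries.coeff n) multisection_eisensteinSix_mul_pow_twentythree
  rwa [coeff_ofNat_mul, coeff_modNineteen_five, PowerSeries.multisection,
    PowerSeries.coeff_mk, coeff_modNineteen_twentythree] at h

theorem partitionCount_odd_power (k n : ℕ) :
    (partitionCount ((19 ^ (2 * k + 1) * (24 * n + 5) + 1) / 24) : ZMod 19) =
      5 * 10 ^ k * (coeffE n : ZMod 19) := by
  induction k generalizing n with
  | zero =>
    rw [show (19 ^ (2 * 0 + 1) * (24 * n + 5) + 1) / 24 = 19 * n + 4 by omega,
      partitionCount_nineteen]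
    ring
  | succ k ih =>
    -- Chosen because 24(19(19n + 3) + 18) + 5 = 19²(24n + 5).
    have h := ih (19 * (19 * n + 3) + 18)
    rw [coeffE_nineteen, coeffF_nineteen] at h
    rw [show 19 ^ (2 * (k + 1) + 1) * (24 * n + 5) =
      19 ^ (2 * k + 1) * (24 * (19 * (19 * n + 3) + 18) + 5) by ring, h, pow_succ]
    have h48 : (6 * 8 : ZMod 19) = 10 := rfl
    linear_combination (5 * 10 ^ k * coeffE n : ZMod 19) * h48

theorem partitionCount_even_power (k n : ℕ) :
    (partitionCount ((19 ^ (2 * k + 2) * (24 * n + 23) + 1) / 24) : ZMod 19) =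
      11 * 10 ^ k * (coeffF n : ZMod 19) := by
  rw [show 19 ^ (2 * k + 2) * (24 * n + 23) = 19 ^ (2 * k + 1) * (24 * (19 * n + 18) + 5) by ring,
    partitionCount_odd_power, coeffE_nineteen]
  have h30 : (5 * 6 : ZMod 19) = 11 := rfl
  linear_combination (10 ^ k * coeffF n : ZMod 19) * h30

end PartitionCongruences

theorem twentyfour_dvd_odd_power (k n : ℕ) : 24 ∣ 19 ^ (2 * k + 1) * (24 * n + 5) + 1 := by
  rw [← ZMod.natCast_eq_zero_iff]
  push_cast
  -- 19² ≡ 1 modulo 24, which leaves 19·5 + 1 = 96 = 4·24.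
  rw [pow_succ, pow_mul, show (19 ^ 2 : ZMod 24) = 1 from rfl, one_pow,
    show (24 : ZMod 24) = 0 from rfl, zero_mul, zero_add]
  rfl

theorem corollary11 (k n : ℕ) :
    (24 ∣ 19 ^ (2 * k + 1) * (24 * n + 5) + 1 ∧
      (partitionCount ((19 ^ (2 * k + 1) * (24 * n + 5) + 1) / 24) : ℤ) ≡
        5 * 10 ^ k * coeffE n [ZMOD 19]) ∧
    (24 ∣ 19 ^ (2 * k + 2) * (24 * n + 23) + 1 ∧
      (partitionCount ((19 ^ (2 * k + 2) * (24 * n + 23) + 1) / 24) : ℤ) ≡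
        11 * 10 ^ k * coeffF n [ZMOD 19]) := by
  refine ⟨⟨twentyfour_dvd_odd_power k n, ?_⟩, ?_, ?_⟩
  · exact (ZMod.intCast_eq_intCast_iff _ _ 19).mp (by
      push_cast
      exact partitionCount_odd_power k n)
  · have := twentyfour_dvd_odd_power k (19 * n + 18)
    rwa [show 19 ^ (2 * k + 1) * (24 * (19 * n + 18) + 5) =
      19 ^ (2 * k + 2) * (24 * n + 23) by ring] at this
  · exact (ZMod.intCast_eq_intCast_iff _ _ 19).mp (by
      push_cast
      exact partitionCount_even_power k n)
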